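/- Let $N<d$, $X\in\mathbb{R}^{N\times d}$, $y\in\mathbb{R}^N$, $L(w)=\tfrac12\|Xw-y\|_2^2$, $\mathcal{E}=\{w\in\mathbb{R}^d : Xw=y\}$, and let $\eta>0$ and $0\le\tau\le 1$. For $\tau\neq 1$ put $\log_\tau x=\frac{x^{1-\tau}-1}{1-\tau}$ and $\exp_\tau x=[1+(1-\tau)x]_+^{1/(1-\tau)}$, and let $\log_1=\log$, $\exp_1=\exp$. For $\alpha>0$ consider the continuous tempered EGU$^\pm$ updates $\frac{d}{dt}\log_\tau w_+=-\eta\nabla L(w)$, $\frac{d}{dt}\log_\tau w_-=+\eta\nabla L(w)$, $w=w_+-w_-$, started at $w_+(0)=w_-(0)=\alpha\mathbf{1}$, understood in integral form: $w_+,w_-:[0,\infty)\to\mathbb{R}^d_{\ge 0}$ are continuous and, coordinatewise for all $t\ge 0$, $$w_\pm(t)=\exp_\tau\Big(\log_\tau(\alpha\mathbf{1})\mp\eta\int_0^t\nabla L\big(w_+(z)-w_-(z)\big)\,dz\Big).$$ Suppose that for all sufficiently small $\alpha>0$ such a trajectory $w^\alpha=w^\alpha_+-w^\alpha_-$ is given,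 that the limit $w^\alpha(\infty)=\lim_{t\to\infty}w^\alpha(t)$ exists, and that $w^\alpha(\infty)\in\mathcal{E}$. Then, as $\alpha\to0^+$, $w^\alpha(\infty)$ converges to a solution of minimum $\mathrm{L}_{2-\tau}$-norm, that is, to a point $w^*\in\mathcal{E}$ with $\|w^*\|_{2-\tau}\le\|v\|_{2-\tau}$ for all $v\in\mathcal{E}$; for $\tau<1$ this $w^*$ is the only minimum $\mathrm{L}_{2-\tau}$-norm element of $\mathcal{E}$. -/

import Mathlib

open Filter Topology
open scoped Matrix

noncomputable section

/-- The tempered logarithm `log_τ x = (x ^ (1 - τ) - 1) / (1 - τ)`, with `log_1 = log`. -/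
def temperedLog (τ x : ℝ) : ℝ :=
  if τ = 1 then Real.log x else (x ^ (1 - τ) - 1) / (1 - τ)

/-- The tempered exponential `exp_τ x = [1 + (1 - τ) x]_+ ^ (1 / (1 - τ))`, with `exp_1 = exp`. -/
def temperedExp (τ x : ℝ) : ℝ :=
  if τ = 1 then Real.exp x else (max 0 (1 + (1 - τ) * x)) ^ (1 / (1 - τ))

/-- `(wp, wm)` is a trajectory, on times `t ≥ 0`, of the continuous tempered EGU^± updates with
temperature `τ` and learning rate `η` for the loss `L`, started at `wp 0 = wm 0 = w₀`.
This is the integral form of `d/dt log_τ wp = -η ∇L(wp - wm)`, `d/dt log_τ wm = η ∇L(wp - wm)`;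
the truncation in `exp_τ` keeps the two weight vectors nonnegative. -/
structure IsTemperedEGUPM {d : ℕ} (τ η : ℝ) (L : EuclideanSpace ℝ (Fin d) → ℝ)
    (w₀ : EuclideanSpace ℝ (Fin d)) (wp wm : ℝ → EuclideanSpace ℝ (Fin d)) : Prop where
  continuousOn_plus : ContinuousOn wp (Set.Ici 0)
  continuousOn_minus : ContinuousOn wm (Set.Ici 0)
  plus_eq : ∀ t : ℝ, 0 ≤ t → ∀ i : Fin d,
    wp t i = temperedExp τ (temperedLog τ (w₀ i)
      - η * ∫ z in (0 : ℝ)..t, (gradient L (wp z - wm z)) i)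
  minus_eq : ∀ t : ℝ, 0 ≤ t → ∀ i : Fin d,
    wm t i = temperedExp τ (temperedLog τ (w₀ i)
      + η * ∫ z in (0 : ℝ)..t, (gradient L (wp z - wm z)) i)

/-- The linear regression loss `L(w) = ½ ‖X w - y‖²`. -/
def regressionLoss {N d : ℕ} (X : Matrix (Fin N) (Fin d) ℝ) (y : Fin N → ℝ)
    (w : EuclideanSpace ℝ (Fin d)) : ℝ :=
  1 / 2 * ∑ n, ((X *ᵥ w.ofLp) n - y n) ^ 2

/-- The set of solutions with zero error, `{w | X w = y}`. -/
def zeroErrorSet {N d : ℕ} (X : Matrix (Fin N) (Fin d) ℝ) (y : Fin N → ℝ) :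
    Set (EuclideanSpace ℝ (Fin d)) :=
  {w | X *ᵥ w.ofLp = y}

/-- The `L_p` norm of a vector. -/
def vecLpNorm {d : ℕ} (p : ℝ) (w : EuclideanSpace ℝ (Fin d)) : ℝ :=
  ‖WithLp.toLp (ENNReal.ofReal p) w.ofLp‖

/-- `w` is an element of `S` of minimum `L_p` norm. -/
def IsMinLpNorm {d : ℕ} (p : ℝ) (S : Set (EuclideanSpace ℝ (Fin d)))
    (w : EuclideanSpace ℝ (Fin d)) : Prop :=
  w ∈ S ∧ ∀ v ∈ S, vecLpNorm p w ≤ vecLpNorm p v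

end

/-! The loss is constant along `ker X`, so the accumulated gradient `S` is orthogonal to `ker X` at
all times (`exists_dual`). The weights are an explicit function of `S`; inverting it turns
orthogonality into a first-order optimality condition for a convex potential on the affine set of
solutions, and this survives `t → ∞`.

For `τ < 1` the inverse is the derivative of `|x| ^ (2 - τ)`, up to scale and an error `α ^ (1 - τ)`
(`abs_sub_oddRpow_le`), so the limit is nearly norm-minimal.

For `τ = 1` the inverse is exactly `arsinh (x / (2 * α))`, the derivative of the hyperbolic entropy,
which equals `-log α * |x| + (|x| log |x| - |x|) + o(1)` at fixed `x`. Its leading term selects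
minimal `L_1` norm; the next term selects one point among those minimisers.

In both cases the limits stay bounded as `α → 0` and all their cluster points solve a problem with
at most one solution, so they converge. -/

theorem exists_tendsto_of_mapClusterPt_unique {ι E : Type*} [TopologicalSpace E] {l : Filter ι}
    [l.NeBot] {f : ι → E} {K : Set E} (hK : IsCompact K) (hf : ∀ᶠ i in l, f i ∈ K)
    {P : E → Prop} (hP : ∀ x, MapClusterPt x l f → P x) (huniq : ∀ x y, P x → P y → x = y) :
    ∃ x, P x ∧ Tendsto f l (𝓝 x) := by
  obtain ⟨x, -, hx⟩ := hK.exists_mapClusterPt_of_frequently hf.frequently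
  exact ⟨x, hP x hx, hK.tendsto_nhds_of_unique_mapClusterPt hf
    fun y _ hy => huniq y x (hP y hy) (hP x hx)⟩

theorem isCompact_coordinate_box (d : ℕ) (R : ℝ) :
    IsCompact {w : EuclideanSpace ℝ (Fin d) | ∀ i, |w i| ≤ R} := by
  have h : IsCompact (Set.univ.pi fun _ : Fin d => Set.Icc (-R) R) :=
    isCompact_univ_pi fun _ => isCompact_Icc
  convert h.image (PiLp.continuous_toLp 2 fun _ : Fin d => ℝ) using 1
  ext w
  constructor
  · intro hw
    exact ⟨w.ofLp, fun i _ => abs_le.1 (hw i), rfl⟩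
  · rintro ⟨u, hu, rfl⟩ i
    exact abs_le.2 (hu i trivial)

/-! ### The regression loss and its zero-error set -/

theorem contDiff_regressionLoss {N d : ℕ} (X : Matrix (Fin N) (Fin d) ℝ) (y : Fin N → ℝ) :
    ContDiff ℝ 1 (regressionLoss X y) := by
  unfold regressionLoss
  simp only [Matrix.mulVec, dotProduct]
  fun_prop

theorem continuous_gradient_regressionLoss {N d : ℕ} (X : Matrix (Fin N) (Fin d) ℝ)
    (y : Fin N → ℝ) : Continuous (gradient (regressionLoss X y)) := by
  unfold gradient
  exact (LinearIsometryEquiv.continuous _).comp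
    ((contDiff_regressionLoss X y).continuous_fderiv one_ne_zero)

/-- The loss does not change along the line `u + t • k`, so its directional derivative there
vanishes. -/
theorem sum_gradient_regressionLoss_mul_eq_zero {N d : ℕ} (X : Matrix (Fin N) (Fin d) ℝ)
    (y : Fin N → ℝ) (u k : EuclideanSpace ℝ (Fin d)) (hk : X *ᵥ k.ofLp = 0) :
    ∑ i, gradient (regressionLoss X y) u i * k i = 0 := by
  have hd : DifferentiableAt ℝ (regressionLoss X y) u :=
    ((contDiff_regressionLoss X y).differentiable one_ne_zero) u
  have h1 : inner ℝ (gradient (regressionLoss X y) u) k = fderiv ℝ (regressionLoss X y) u k := by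
    simp [gradient]
  have h2 : lineDeriv ℝ (regressionLoss X y) u k = 0 := by
    unfold lineDeriv
    have : (fun t : ℝ => regressionLoss X y (u + t • k)) = fun _ => regressionLoss X y u := by
      funext t
      simp [regressionLoss, Matrix.mulVec_add, Matrix.mulVec_smul, hk]
    rw [this, deriv_const]
  rw [hd.lineDeriv_eq_fderiv] at h2
  rw [h2, PiLp.inner_apply] at h1
  simpa [mul_comm] using h1

/-- The accumulated gradient of the regression loss is orthogonal to the kernel of `X`. -/
theorem IsTemperedEGUPM.exists_dual {N d : ℕ} {X : Matrix (Fin N) (Fin d) ℝ} {y : Fin N → ℝ}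
    {τ η α : ℝ} {wp wm : ℝ → EuclideanSpace ℝ (Fin d)}
    (h : IsTemperedEGUPM τ η (regressionLoss X y) (WithLp.toLp 2 fun _ => α) wp wm)
    {t : ℝ} (ht : 0 ≤ t) :
    ∃ S : Fin d → ℝ,
      (∀ k : EuclideanSpace ℝ (Fin d), X *ᵥ k.ofLp = 0 → ∑ i, S i * k i = 0) ∧
      ∀ i, (wp t - wm t) i = temperedExp τ (temperedLog τ α + S i)
        - temperedExp τ (temperedLog τ α - S i) := by
  refine ⟨fun i => -(η * ∫ z in (0 : ℝ)..t, gradient (regressionLoss X y) (wp z - wm z) i),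
    fun k hk => ?_, fun i => ?_⟩
  · have hcont : ∀ i, ContinuousOn
        (fun z => gradient (regressionLoss X y) (wp z - wm z) i) (Set.uIcc 0 t) := by
      intro i
      have h1 : ContinuousOn (fun z => wp z - wm z) (Set.uIcc 0 t) :=
        (h.continuousOn_plus.sub h.continuousOn_minus).mono
          (by rw [Set.uIcc_of_le ht]; exact Set.Icc_subset_Ici_self)
      have h2 : Continuous fun u => gradient (regressionLoss X y) u i :=
        (PiLp.continuous_apply 2 _ i).comp (continuous_gradient_regressionLoss X y)
      exact h2.comp_continuousOn h1
    have hsum : ∑ i, (∫ z in (0 : ℝ)..t, gradient (regressionLoss X y) (wp z - wm z) i) * k i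
        = 0 := by
      simp_rw [← intervalIntegral.integral_mul_const]
      rw [← intervalIntegral.integral_finsetSum
        fun i _ => (hcont i).intervalIntegrable.mul_const (k i)]
      simp [sum_gradient_regressionLoss_mul_eq_zero X y _ k hk]
    calc _ = -η * ∑ i, (∫ z in (0 : ℝ)..t,
          gradient (regressionLoss X y) (wp z - wm z) i) * k i := by
          rw [Finset.mul_sum]
          exact Finset.sum_congr rfl fun i _ => by ring
      _ = 0 := by rw [hsum, mul_zero]
  · have h1 := h.plus_eq t ht i
    have h2 := h.minus_eq t ht i
    simp only [PiLp.sub_apply, sub_neg_eq_add, ← sub_eq_add_neg] at h1 h2 ⊢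
    rw [h1, h2]

theorem mulVec_sub_eq_zero_of_mem_zeroErrorSet {N d : ℕ} {X : Matrix (Fin N) (Fin d) ℝ}
    {y : Fin N → ℝ} {v w : EuclideanSpace ℝ (Fin d)} (hv : v ∈ zeroErrorSet X y)
    (hw : w ∈ zeroErrorSet X y) : X *ᵥ (v - w).ofLp = 0 := by
  have hv' : X *ᵥ v.ofLp = y := hv
  have hw' : X *ᵥ w.ofLp = y := hw
  rw [WithLp.ofLp_sub, Matrix.mulVec_sub, hv', hw', sub_self]

theorem midpoint_mem_zeroErrorSet {N d : ℕ} {X : Matrix (Fin N) (Fin d) ℝ}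
    {y : Fin N → ℝ} {v w : EuclideanSpace ℝ (Fin d)} (hv : v ∈ zeroErrorSet X y)
    (hw : w ∈ zeroErrorSet X y) : (1 / 2 : ℝ) • (v + w) ∈ zeroErrorSet X y := by
  have hv' : X *ᵥ v.ofLp = y := hv
  have hw' : X *ᵥ w.ofLp = y := hw
  change X *ᵥ _ = y
  rw [WithLp.ofLp_smul, WithLp.ofLp_add, Matrix.mulVec_smul, Matrix.mulVec_add, hv', hw',
    ← two_smul ℝ y, smul_smul]
  norm_num

theorem isClosed_zeroErrorSet {N d : ℕ} (X : Matrix (Fin N) (Fin d) ℝ) (y : Fin N → ℝ) :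
    IsClosed (zeroErrorSet X y) := by
  have h : Continuous fun w : EuclideanSpace ℝ (Fin d) => X *ᵥ w.ofLp :=
    continuous_const.matrix_mulVec (PiLp.continuous_ofLp 2 _)
  exact isClosed_eq h continuous_const

theorem vecLpNorm_le_iff {d : ℕ} {p : ℝ} (hp : 0 < p) (v w : EuclideanSpace ℝ (Fin d)) :
    vecLpNorm p v ≤ vecLpNorm p w ↔ ∑ i, |v i| ^ p ≤ ∑ i, |w i| ^ p := by
  have hp' : (ENNReal.ofReal p).toReal = p := ENNReal.toReal_ofReal hp.le
  unfold vecLpNorm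
  rw [PiLp.norm_eq_sum (by rwa [hp']), PiLp.norm_eq_sum (by rwa [hp'])]
  simp only [hp', Real.norm_eq_abs]
  exact Real.rpow_le_rpow_iff (by positivity) (by positivity) (by positivity)

/-! ### Temperature below one: power potentials -/

/-- The odd extension of `x ↦ x ^ q`. -/
noncomputable def oddRpow (q x : ℝ) : ℝ := max x 0 ^ q - max (-x) 0 ^ q

theorem oddRpow_neg (q x : ℝ) : oddRpow q (-x) = -oddRpow q x := by
  simp [oddRpow]

theorem oddRpow_of_nonneg {q x : ℝ} (hq : q ≠ 0) (hx : 0 ≤ x) : oddRpow q x = x ^ q := by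
  simp [oddRpow, hx, Real.zero_rpow hq]

theorem continuous_oddRpow {q : ℝ} (hq : 0 ≤ q) : Continuous (oddRpow q) := by
  unfold oddRpow
  exact ((continuous_id.max continuous_const).rpow_const fun _ => Or.inr hq).sub
    ((continuous_neg.max continuous_const).rpow_const fun _ => Or.inr hq)

/-- By oddness take `s ≥ 0`. Dropping the subtracted term bounds the odd power by `a + s`. For the
other side, either `s ≤ a` and nonnegativity suffices, or the truncation kills the subtracted term
and the odd power is exactly `a + s`. -/
theorem abs_sub_oddRpow_le {q a : ℝ} (hq : 0 < q) (ha : 0 ≤ a) (s : ℝ) :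
    |s - oddRpow q (max 0 (a + s) ^ (1 / q) - max 0 (a - s) ^ (1 / q))| ≤ a := by
  wlog hs : 0 ≤ s generalizing s
  · have := this (-s) (by linarith)
    rw [sub_neg_eq_add, ← sub_eq_add_neg, ← neg_sub (max 0 (a + s) ^ (1 / q)), oddRpow_neg,
      ← neg_sub', abs_neg] at this
    exact this
  have hinv : ∀ x : ℝ, 0 ≤ x → (x ^ (1 / q)) ^ q = x := fun x hx => by
    rw [← Real.rpow_mul hx, one_div_mul_cancel hq.ne', Real.rpow_one]
  have hmono : max 0 (a - s) ^ (1 / q) ≤ max 0 (a + s) ^ (1 / q) :=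
    Real.rpow_le_rpow (le_max_left _ _) (max_le_max le_rfl (by linarith)) (by positivity)
  rw [oddRpow_of_nonneg hq.ne' (sub_nonneg.2 hmono), abs_le]
  rw [max_eq_right (show 0 ≤ a + s by linarith)] at hmono ⊢
  constructor
  · have : ((a + s) ^ (1 / q) - max 0 (a - s) ^ (1 / q)) ^ q ≤ ((a + s) ^ (1 / q)) ^ q :=
      Real.rpow_le_rpow (sub_nonneg.2 hmono)
        (sub_le_self _ (Real.rpow_nonneg (le_max_left _ _) _)) hq.le
    rw [hinv _ (by linarith)] at this
    linarith
  · rcases le_total s a with h | h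
    · have := Real.rpow_nonneg (sub_nonneg.2 hmono) q
      linarith
    · rw [max_eq_left (by linarith : a - s ≤ 0), Real.zero_rpow (by positivity), sub_zero,
        hinv _ (by linarith)]
      linarith

/-- This is the tangent inequality for the convex function `|x| ^ (1 + q)`, obtained from Young's
inequality for `|v| * w ^ q`. -/
theorem abs_rpow_add_oddRpow_mul_le {q : ℝ} (hq : 0 < q) (w v : ℝ) :
    |w| ^ (1 + q) + (1 + q) * (oddRpow q w * (v - w)) ≤ |v| ^ (1 + q) := by
  wlog hw : 0 ≤ w generalizing w v
  · have := this (-w) (-v) (by linarith)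
    rw [abs_neg, abs_neg, oddRpow_neg] at this
    linarith
  have hp : 0 < 1 + q := by linarith
  rw [oddRpow_of_nonneg hq.ne' hw, abs_of_nonneg hw]
  have hyoung := Real.geom_mean_le_arith_mean2_weighted (w₁ := 1 / (1 + q)) (w₂ := q / (1 + q))
    (p₁ := |v| ^ (1 + q)) (p₂ := w ^ (1 + q)) (by positivity) (by positivity) (by positivity)
    (by positivity) (by field_simp)
  rw [← Real.rpow_mul (abs_nonneg v), ← Real.rpow_mul hw, mul_one_div_cancel hp.ne',
    Real.rpow_one, mul_div_cancel₀ _ hp.ne'] at hyoung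
  have h1 : w ^ (1 + q) = w ^ q * w := by
    rw [add_comm, Real.rpow_add_one' hw (by linarith)]
  have h2 : w ^ q * v ≤ |v| * w ^ q := by
    rw [mul_comm]
    exact mul_le_mul_of_nonneg_right (le_abs_self v) (Real.rpow_nonneg hw q)
  have h3 : (1 + q) * (|v| * w ^ q) ≤ |v| ^ (1 + q) + q * w ^ (1 + q) := by
    calc _ ≤ (1 + q) * (1 / (1 + q) * |v| ^ (1 + q) + q / (1 + q) * w ^ (1 + q)) :=
          mul_le_mul_of_nonneg_left hyoung hp.le
      _ = _ := by field_simp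
  have h4 := mul_le_mul_of_nonneg_left h2 hp.le
  rw [h1] at h3 ⊢
  nlinarith

theorem abs_half_add_rpow_lt {p : ℝ} (hp : 1 < p) {a b : ℝ} (hab : a ≠ b) :
    |1 / 2 * (a + b)| ^ p < (|a| ^ p + |b| ^ p) / 2 := by
  have hp0 : 0 < p := by linarith
  have hle : |1 / 2 * (a + b)| ≤ (|a| + |b|) / 2 := by
    rw [abs_mul, abs_of_pos (by norm_num : (0 : ℝ) < 1 / 2)]
    linarith [abs_add_le a b]
  rcases eq_or_ne |a| |b| with h | h
  -- When the moduli agree, strictness comes from the cancellation in `a = -b ≠ 0`, not from strict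
  -- convexity of the power.
  · rcases abs_eq_abs.1 h with h | h
    · exact absurd h hab
    · have hb : b ≠ 0 := by
        rintro rfl
        exact hab (by simpa using h)
      subst h
      have : 0 < |b| ^ p := Real.rpow_pos_of_pos (abs_pos.2 hb) p
      simp only [neg_add_cancel, mul_zero, abs_zero, Real.zero_rpow hp0.ne', abs_neg]
      linarith
  · have := (strictConvexOn_rpow hp).2 (abs_nonneg a) (abs_nonneg b) h
      (by norm_num : (0 : ℝ) < 1 / 2) (by norm_num : (0 : ℝ) < 1 / 2) (by norm_num)
    simp only [smul_eq_mul] at this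
    calc _ ≤ ((|a| + |b|) / 2) ^ p := Real.rpow_le_rpow (abs_nonneg _) hle hp0.le
      _ = (1 / 2 * |a| + 1 / 2 * |b|) ^ p := by ring_nf
      _ < _ := this
      _ = _ := by ring

theorem IsMinLpNorm.unique {N d : ℕ} {X : Matrix (Fin N) (Fin d) ℝ} {y : Fin N → ℝ} {p : ℝ}
    (hp : 1 < p) {v w : EuclideanSpace ℝ (Fin d)} (hv : IsMinLpNorm p (zeroErrorSet X y) v)
    (hw : IsMinLpNorm p (zeroErrorSet X y) w) : v = w := by
  by_contra hne
  obtain ⟨i, hi⟩ : ∃ i, v i ≠ w i := by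
    by_contra! h
    exact hne (PiLp.ext h)
  have hp0 : 0 < p := by linarith
  have hm := midpoint_mem_zeroErrorSet hv.1 hw.1
  have h1 := (vecLpNorm_le_iff hp0 _ _).1 (hv.2 _ hm)
  have h2 := (vecLpNorm_le_iff hp0 _ _).1 (hw.2 _ hm)
  have h3 : ∑ i, |((1 / 2 : ℝ) • (v + w)) i| ^ p < ∑ i, (|v i| ^ p + |w i| ^ p) / 2 := by
    refine Finset.sum_lt_sum (fun j _ => ?_) ⟨i, Finset.mem_univ i, ?_⟩
    · by_cases hj : v j = w j
      · simp only [PiLp.smul_apply, PiLp.add_apply, smul_eq_mul, hj]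
        ring_nf
        exact le_rfl
      · exact (abs_half_add_rpow_lt hp hj).le
    · exact abs_half_add_rpow_lt hp hi
  rw [← Finset.sum_div, Finset.sum_add_distrib] at h3
  linarith

/-- Since `1 + (1 - τ) * (log_τ α ± S) = α ^ (1 - τ) ± (1 - τ) * S`, the scalar estimate applies
with `a = α ^ (1 - τ)`. -/
theorem abs_dual_sub_oddRpow_le {τ α : ℝ} (hτ : τ < 1) (hα : 0 < α) (S : ℝ) :
    |(1 - τ) * S - oddRpow (1 - τ) (temperedExp τ (temperedLog τ α + S)
      - temperedExp τ (temperedLog τ α - S))| ≤ α ^ (1 - τ) := by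
  have hq : 0 < 1 - τ := by linarith
  have h := abs_sub_oddRpow_le hq (Real.rpow_nonneg hα.le (1 - τ)) ((1 - τ) * S)
  convert h using 4
  unfold temperedExp temperedLog
  simp only [hτ.ne, if_false]
  congr 3
  · field_simp
    ring
  · field_simp
    ring

/-- At each time `S` annihilates `v - w`, and the odd powers differ from `(1 - τ) * S` by at most `α
^ (1 - τ)`. The bound involves neither `t` nor `S`, so it passes to the limit. -/
theorem abs_sum_oddRpow_mul_sub_le {N d : ℕ} {X : Matrix (Fin N) (Fin d) ℝ} {y : Fin N → ℝ}
    {τ η α : ℝ} (hτ : τ < 1) (hα : 0 < α) {wp wm : ℝ → EuclideanSpace ℝ (Fin d)}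
    {w v : EuclideanSpace ℝ (Fin d)}
    (h : IsTemperedEGUPM τ η (regressionLoss X y) (WithLp.toLp 2 fun _ => α) wp wm)
    (hlim : Tendsto (fun t => wp t - wm t) atTop (𝓝 w)) (hw : w ∈ zeroErrorSet X y)
    (hv : v ∈ zeroErrorSet X y) :
    |∑ i, oddRpow (1 - τ) (w i) * (v i - w i)| ≤ α ^ (1 - τ) * ∑ i, |v i - w i| := by
  have hq : 0 < 1 - τ := by linarith
  have hc : Tendsto (fun t => |∑ i, oddRpow (1 - τ) ((wp t - wm t) i) * (v i - w i)|) atTop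
      (𝓝 |∑ i, oddRpow (1 - τ) (w i) * (v i - w i)|) := by
    have : Continuous fun u : EuclideanSpace ℝ (Fin d) =>
        |∑ i, oddRpow (1 - τ) (u i) * (v i - w i)| := by
      refine (continuous_finsetSum _ fun i _ => ?_).abs
      exact ((continuous_oddRpow hq.le).comp (PiLp.continuous_apply 2 _ i)).mul continuous_const
    exact (this.tendsto w).comp hlim
  refine le_of_tendsto hc ?_
  filter_upwards [eventually_ge_atTop 0] with t ht
  obtain ⟨S, hS, hwt⟩ := h.exists_dual ht
  have hS0 : ∑ i, S i * (v i - w i) = 0 :=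
    hS (v - w) (mulVec_sub_eq_zero_of_mem_zeroErrorSet hv hw)
  have heq : ∑ i, oddRpow (1 - τ) ((wp t - wm t) i) * (v i - w i)
      = -∑ i, ((1 - τ) * S i - oddRpow (1 - τ) ((wp t - wm t) i)) * (v i - w i) := by
    have : ∑ i, (1 - τ) * S i * (v i - w i) = 0 := by
      simp_rw [mul_assoc]
      rw [← Finset.mul_sum, hS0, mul_zero]
    simp_rw [sub_mul ((1 - τ) * _)]
    rw [Finset.sum_sub_distrib, this]
    ring
  rw [heq, abs_neg, Finset.mul_sum]
  refine (Finset.abs_sum_le_sum_abs _ _).trans (Finset.sum_le_sum fun i _ => ?_)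
  rw [abs_mul, hwt]
  exact mul_le_mul_of_nonneg_right (abs_dual_sub_oddRpow_le hτ hα (S i)) (abs_nonneg _)

theorem sum_abs_rpow_le_of_limit {N d : ℕ} {X : Matrix (Fin N) (Fin d) ℝ} {y : Fin N → ℝ}
    {τ η α : ℝ} (hτ : τ < 1) (hα : 0 < α) {wp wm : ℝ → EuclideanSpace ℝ (Fin d)}
    {w v : EuclideanSpace ℝ (Fin d)}
    (h : IsTemperedEGUPM τ η (regressionLoss X y) (WithLp.toLp 2 fun _ => α) wp wm)
    (hlim : Tendsto (fun t => wp t - wm t) atTop (𝓝 w)) (hw : w ∈ zeroErrorSet X y)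
    (hv : v ∈ zeroErrorSet X y) :
    ∑ i, |w i| ^ (2 - τ) ≤
      ∑ i, |v i| ^ (2 - τ) + (2 - τ) * α ^ (1 - τ) * ∑ i, |v i - w i| := by
  have h1 := (abs_le.1 (abs_sum_oddRpow_mul_sub_le hτ hα h hlim hw hv)).1
  have h2 : ∑ i, (|w i| ^ (2 - τ) + (2 - τ) * (oddRpow (1 - τ) (w i) * (v i - w i)))
      ≤ ∑ i, |v i| ^ (2 - τ) := by
    refine Finset.sum_le_sum fun i _ => ?_
    have := abs_rpow_add_oddRpow_mul_le (show 0 < 1 - τ by linarith) (w i) (v i)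
    rwa [show 1 + (1 - τ) = 2 - τ by ring] at this
  rw [Finset.sum_add_distrib, ← Finset.mul_sum] at h2
  have h3 := mul_le_mul_of_nonneg_left h1 (show 0 ≤ 2 - τ by linarith)
  linarith

theorem abs_le_one_add_abs_rpow {p : ℝ} (hp : 1 ≤ p) (x : ℝ) : |x| ≤ 1 + |x| ^ p := by
  rcases le_total |x| 1 with h | h
  · linarith [Real.rpow_nonneg (abs_nonneg x) p]
  · linarith [Real.self_le_rpow_of_one_le h hp]

theorem exists_tendsto_isMinLpNorm_of_lt_one {N d : ℕ} {X : Matrix (Fin N) (Fin d) ℝ}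
    {y : Fin N → ℝ} {τ η : ℝ} (hτ : τ < 1)
    {wp wm : ℝ → ℝ → EuclideanSpace ℝ (Fin d)} {winf : ℝ → EuclideanSpace ℝ (Fin d)}
    (hflow : ∀ᶠ α in 𝓝[>] (0 : ℝ),
      IsTemperedEGUPM τ η (regressionLoss X y) (WithLp.toLp 2 fun _ => α) (wp α) (wm α))
    (hlim : ∀ᶠ α in 𝓝[>] (0 : ℝ),
      Tendsto (fun t => wp α t - wm α t) atTop (𝓝 (winf α)))
    (hmem : ∀ᶠ α in 𝓝[>] (0 : ℝ), winf α ∈ zeroErrorSet X y) :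
    ∃ w, IsMinLpNorm (2 - τ) (zeroErrorSet X y) w ∧ Tendsto winf (𝓝[>] (0 : ℝ)) (𝓝 w) := by
  have hq : 0 < 1 - τ := by linarith
  have hp : 0 < 2 - τ := by linarith
  have hpos : ∀ᶠ α in 𝓝[>] (0 : ℝ), 0 < α := eventually_mem_nhdsWithin
  have hkey : ∀ v ∈ zeroErrorSet X y, ∀ᶠ α in 𝓝[>] (0 : ℝ), ∑ i, |winf α i| ^ (2 - τ) ≤
      ∑ i, |v i| ^ (2 - τ) + (2 - τ) * α ^ (1 - τ) * ∑ i, |v i - winf α i| := by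
    intro v hv
    filter_upwards [hflow, hlim, hmem, hpos] with α h1 h2 h3 h4
    exact sum_abs_rpow_le_of_limit hτ h4 h1 h2 h3 hv
  have hsmall : Tendsto (fun α : ℝ => (2 - τ) * α ^ (1 - τ)) (𝓝[>] (0 : ℝ)) (𝓝 0) := by
    have : Continuous fun α : ℝ => (2 - τ) * α ^ (1 - τ) :=
      continuous_const.mul (continuous_id.rpow_const fun _ => Or.inr hq.le)
    have h := (this.tendsto 0).mono_left (nhdsWithin_le_nhds (s := Set.Ioi 0))
    simpa [Real.zero_rpow hq.ne'] using h
  obtain ⟨α₀, hv₀⟩ := hmem.exists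
  set v₀ := winf α₀
  -- With error factor at most `1/2`, the key bound reads `A ≤ V + (∑ |v₀ i| + d + A) / 2` for `A =
  -- ∑ |winf α i| ^ (2 - τ)` and `V = ∑ |v₀ i| ^ (2 - τ)`; absorbing `A / 2` gives `A ≤ M`.
  set M : ℝ := 2 * ∑ i, |v₀ i| ^ (2 - τ) + ∑ i, |v₀ i| + d with hM
  have hbound : ∀ᶠ α in 𝓝[>] (0 : ℝ), winf α ∈
      {w : EuclideanSpace ℝ (Fin d) | ∀ i, |w i| ≤ 1 + M} := by
    filter_upwards [hkey v₀ hv₀, hsmall.eventually (ge_mem_nhds (by norm_num : (0 : ℝ) < 1 / 2)),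
      hpos] with α h1 h2 h3 i
    have h4 : ∑ i, |v₀ i - winf α i| ≤ ∑ i, |v₀ i| + (d + ∑ i, |winf α i| ^ (2 - τ)) := by
      calc _ ≤ ∑ i, (|v₀ i| + (1 + |winf α i| ^ (2 - τ))) := by
            refine Finset.sum_le_sum fun i _ => (abs_sub _ _).trans ?_
            linarith [abs_le_one_add_abs_rpow (show 1 ≤ 2 - τ by linarith) (winf α i)]
        _ = _ := by simp [Finset.sum_add_distrib]
    have h5 : (2 - τ) * α ^ (1 - τ) * ∑ i, |v₀ i - winf α i| ≤
        1 / 2 * ∑ i, |v₀ i - winf α i| :=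
      mul_le_mul_of_nonneg_right h2 (Finset.sum_nonneg fun i _ => abs_nonneg _)
    have h6 : |winf α i| ^ (2 - τ) ≤ ∑ i, |winf α i| ^ (2 - τ) :=
      Finset.single_le_sum (f := fun i => |winf α i| ^ (2 - τ))
        (fun i _ => Real.rpow_nonneg (abs_nonneg _) _) (Finset.mem_univ i)
    have h7 := abs_le_one_add_abs_rpow (show 1 ≤ 2 - τ by linarith) (winf α i)
    linarith
  refine exists_tendsto_of_mapClusterPt_unique (isCompact_coordinate_box d (1 + M)) hbound
    (fun w hw => ?_) fun v w hv hw => hv.unique (by linarith) hw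
  obtain ⟨U, hU, hUw⟩ := mapClusterPt_iff_ultrafilter.1 hw
  refine ⟨(isClosed_zeroErrorSet X y).mem_of_tendsto hUw (hU hmem), fun v hv => ?_⟩
  rw [vecLpNorm_le_iff hp]
  have hcoord : ∀ i, Tendsto (fun α => winf α i) U (𝓝 (w i)) := fun i =>
    ((PiLp.continuous_apply 2 _ i).tendsto w).comp hUw
  have hl : Tendsto (fun α => ∑ i, |winf α i| ^ (2 - τ)) U (𝓝 (∑ i, |w i| ^ (2 - τ))) :=
    tendsto_finsetSum _ fun i _ => (hcoord i).abs.rpow_const (Or.inr hp.le)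
  have hr : Tendsto (fun α => ∑ i, |v i| ^ (2 - τ)
      + (2 - τ) * α ^ (1 - τ) * ∑ i, |v i - winf α i|) U
      (𝓝 (∑ i, |v i| ^ (2 - τ) + 0 * ∑ i, |v i - w i|)) :=
    tendsto_const_nhds.add ((hsmall.mono_left hU).mul
      (tendsto_finsetSum _ fun i _ => (tendsto_const_nhds.sub (hcoord i)).abs))
  simpa using le_of_tendsto_of_tendsto hl hr (hU (hkey v hv))

/-! ### Temperature one: hyperbolic entropy -/

theorem cosh_add_sinh_mul_le_cosh (s t : ℝ) :
    Real.cosh t + Real.sinh t * (s - t) ≤ Real.cosh s := by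
  have h1 : Real.exp t * (1 + (s - t)) ≤ Real.exp s := by
    calc _ ≤ Real.exp t * Real.exp (s - t) :=
          mul_le_mul_of_nonneg_left (by linarith [Real.add_one_le_exp (s - t)])
            (Real.exp_pos t).le
      _ = _ := by rw [← Real.exp_add]; ring_nf
  have h2 : Real.exp (-t) * (1 - (s - t)) ≤ Real.exp (-s) := by
    calc _ ≤ Real.exp (-t) * Real.exp (-(s - t)) :=
          mul_le_mul_of_nonneg_left (by linarith [Real.add_one_le_exp (-(s - t))])
            (Real.exp_pos _).le
      _ = _ := by rw [← Real.exp_add]; ring_nf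
  rw [Real.cosh_eq, Real.cosh_eq, Real.sinh_eq]
  linarith

/-- The hyperbolic entropy at scale `α`. -/
noncomputable def hyperbolicEntropy (α x : ℝ) : ℝ :=
  x * Real.arsinh (x / (2 * α)) - √(x ^ 2 + 4 * α ^ 2)

/-- The hyperbolic entropy at scale `α`, without its leading term `-log α * |x|`. -/
noncomputable def entropyRemainder (α x : ℝ) : ℝ :=
  |x| * Real.log ((|x| + √(x ^ 2 + 4 * α ^ 2)) / 2) - √(x ^ 2 + 4 * α ^ 2)

/-- The entropy is the convex conjugate of `2 * α * cosh`. In the dual variables `arsinh (· / (2 *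
α))` the claim becomes the tangent inequality for `cosh`, with the tangent taken at the dual point
of `v`. -/
theorem hyperbolicEntropy_add_arsinh_mul_le {α : ℝ} (hα : 0 < α) (w v : ℝ) :
    hyperbolicEntropy α w + Real.arsinh (w / (2 * α)) * (v - w) ≤ hyperbolicEntropy α v := by
  have hsqrt : ∀ x : ℝ, √(x ^ 2 + 4 * α ^ 2) = 2 * α * Real.cosh (Real.arsinh (x / (2 * α))) := by
    intro x
    rw [Real.cosh_arsinh, ← Real.sqrt_sq (show 0 ≤ 2 * α by positivity),
      ← Real.sqrt_mul (by positivity), Real.sqrt_sq (show 0 ≤ 2 * α by positivity)]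
    congr 1
    field_simp
    ring
  have hsinh : 2 * α * Real.sinh (Real.arsinh (v / (2 * α))) = v := by
    rw [Real.sinh_arsinh, mul_div_cancel₀ _ (by positivity)]
  unfold hyperbolicEntropy
  rw [hsqrt, hsqrt]
  have h := mul_le_mul_of_nonneg_left (cosh_add_sinh_mul_le_cosh (Real.arsinh (w / (2 * α)))
    (Real.arsinh (v / (2 * α)))) (show 0 ≤ 2 * α by positivity)
  rw [mul_add, ← mul_assoc (2 * α) (Real.sinh _), hsinh] at h
  linarith

theorem hyperbolicEntropy_eq {α : ℝ} (hα : 0 < α) (x : ℝ) :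
    hyperbolicEntropy α x = -Real.log α * |x| + entropyRemainder α x := by
  have habs : x * Real.arsinh (x / (2 * α)) = |x| * Real.arsinh (|x| / (2 * α)) := by
    rcases abs_choice x with h | h <;> rw [h]
    rw [neg_div, Real.arsinh_neg, neg_mul_neg]
  rcases eq_or_ne x 0 with rfl | hx
  · simp [hyperbolicEntropy, entropyRemainder]
  have hpos : 0 < |x| + √(x ^ 2 + 4 * α ^ 2) :=
    add_pos_of_pos_of_nonneg (abs_pos.2 hx) (Real.sqrt_nonneg _)
  have h1 : √(1 + (|x| / (2 * α)) ^ 2) = √(x ^ 2 + 4 * α ^ 2) / (2 * α) := by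
    rw [← Real.sqrt_sq (show 0 ≤ 2 * α by positivity), ← Real.sqrt_div (by positivity),
      Real.sqrt_sq (show 0 ≤ 2 * α by positivity), div_pow, sq_abs]
    congr 1
    field_simp
    ring
  have h2 : |x| / (2 * α) + √(x ^ 2 + 4 * α ^ 2) / (2 * α)
      = (|x| + √(x ^ 2 + 4 * α ^ 2)) / 2 / α := by
    field_simp
  unfold hyperbolicEntropy entropyRemainder
  rw [habs, Real.arsinh, h1, h2, Real.log_div (by positivity) hα.ne']
  ring

/-- Uniformity in `x` matters: this is applied at the moving point `winf α`, whereas the pointwise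
limit suffices at a fixed competitor. -/
theorem abs_mul_log_sub_abs_le_entropyRemainder {α : ℝ} (hα : 0 ≤ α) (x : ℝ) :
    |x| * Real.log |x| - |x| - 2 * α ≤ entropyRemainder α x := by
  have h1 : √(x ^ 2 + 4 * α ^ 2) ≤ |x| + 2 * α := by
    rw [Real.sqrt_le_left (by positivity), add_sq, sq_abs]
    nlinarith [mul_nonneg (abs_nonneg x) hα]
  have h2 : |x| ≤ √(x ^ 2 + 4 * α ^ 2) := Real.abs_le_sqrt (by nlinarith)
  unfold entropyRemainder
  have h3 : |x| * Real.log |x| ≤ |x| * Real.log ((|x| + √(x ^ 2 + 4 * α ^ 2)) / 2) := by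
    rcases eq_or_ne x 0 with rfl | hx
    · simp
    · exact mul_le_mul_of_nonneg_left
        (Real.log_le_log (abs_pos.2 hx) (by linarith)) (abs_nonneg x)
  linarith

theorem tendsto_entropyRemainder (x : ℝ) :
    Tendsto (fun α => entropyRemainder α x) (𝓝 0) (𝓝 (|x| * Real.log |x| - |x|)) := by
  have hs : Tendsto (fun α : ℝ => √(x ^ 2 + 4 * α ^ 2)) (𝓝 0) (𝓝 |x|) := by
    have : Continuous fun α : ℝ => √(x ^ 2 + 4 * α ^ 2) := by fun_prop
    simpa [Real.sqrt_sq_eq_abs] using this.tendsto 0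
  unfold entropyRemainder
  refine Tendsto.sub ?_ hs
  rcases eq_or_ne x 0 with rfl | hx
  · simp
  · refine tendsto_const_nhds.mul (Tendsto.log ?_ (abs_ne_zero.2 hx))
    convert (tendsto_const_nhds.add hs).div_const 2 using 2
    ring

theorem neg_one_le_mul_log_sub {x : ℝ} (hx : 0 ≤ x) : -1 ≤ x * Real.log x - x := by
  rcases hx.eq_or_lt with rfl | hx
  · simp
  · have h := mul_le_mul_of_nonneg_left (Real.one_sub_inv_le_log_of_pos hx) hx.le
    rw [mul_sub, mul_inv_cancel₀ hx.ne'] at h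
    linarith

/-- The difference of exponentials is exactly `2 * α * sinh S`, so inversion costs no error. -/
theorem arsinh_temperedExp_one_sub {α : ℝ} (hα : 0 < α) (S : ℝ) :
    Real.arsinh ((temperedExp 1 (temperedLog 1 α + S) - temperedExp 1 (temperedLog 1 α - S))
      / (2 * α)) = S := by
  have h : (temperedExp 1 (temperedLog 1 α + S) - temperedExp 1 (temperedLog 1 α - S))
      / (2 * α) = Real.sinh S := by
    simp only [temperedExp, temperedLog, if_true, sub_eq_add_neg (Real.log α), Real.exp_add,
      Real.exp_log hα, Real.sinh_eq]
    field_simp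
  rw [h, Real.arsinh_sinh]

theorem sum_hyperbolicEntropy_le_of_limit {N d : ℕ} {X : Matrix (Fin N) (Fin d) ℝ}
    {y : Fin N → ℝ} {η α : ℝ} (hα : 0 < α) {wp wm : ℝ → EuclideanSpace ℝ (Fin d)}
    {w v : EuclideanSpace ℝ (Fin d)}
    (h : IsTemperedEGUPM 1 η (regressionLoss X y) (WithLp.toLp 2 fun _ => α) wp wm)
    (hlim : Tendsto (fun t => wp t - wm t) atTop (𝓝 w)) (hw : w ∈ zeroErrorSet X y)
    (hv : v ∈ zeroErrorSet X y) :
    ∑ i, hyperbolicEntropy α (w i) ≤ ∑ i, hyperbolicEntropy α (v i) := by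
  have hzero : ∑ i, Real.arsinh (w i / (2 * α)) * (v i - w i) = 0 := by
    have hcont : Continuous fun u : EuclideanSpace ℝ (Fin d) =>
        ∑ i, Real.arsinh (u i / (2 * α)) * (v i - w i) := by
      refine continuous_finsetSum _ fun i _ => ?_
      exact (Real.continuous_arsinh.comp
        ((PiLp.continuous_apply 2 _ i).div_const _)).mul continuous_const
    refine tendsto_nhds_unique ((hcont.tendsto w).comp hlim)
      (tendsto_const_nhds.congr' ?_)
    filter_upwards [eventually_ge_atTop 0] with t ht
    obtain ⟨S, hS, hwt⟩ := h.exists_dual ht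
    simp only [Function.comp_apply, hwt, arsinh_temperedExp_one_sub hα]
    exact (hS (v - w) (mulVec_sub_eq_zero_of_mem_zeroErrorSet hv hw)).symm
  calc _ = ∑ i, (hyperbolicEntropy α (w i) + Real.arsinh (w i / (2 * α)) * (v i - w i)) := by
        rw [Finset.sum_add_distrib, hzero, add_zero]
    _ ≤ _ := Finset.sum_le_sum fun i _ => hyperbolicEntropy_add_arsinh_mul_le hα _ _

theorem log_mul_sum_abs_add_entropyRemainder_le {N d : ℕ} {X : Matrix (Fin N) (Fin d) ℝ}
    {y : Fin N → ℝ} {η α : ℝ} (hα : 0 < α) {wp wm : ℝ → EuclideanSpace ℝ (Fin d)}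
    {w v : EuclideanSpace ℝ (Fin d)}
    (h : IsTemperedEGUPM 1 η (regressionLoss X y) (WithLp.toLp 2 fun _ => α) wp wm)
    (hlim : Tendsto (fun t => wp t - wm t) atTop (𝓝 w)) (hw : w ∈ zeroErrorSet X y)
    (hv : v ∈ zeroErrorSet X y) :
    -Real.log α * ∑ i, |w i| + ∑ i, (|w i| * Real.log |w i| - |w i|) ≤
      -Real.log α * ∑ i, |v i| + (∑ i, entropyRemainder α (v i) + d * (2 * α)) := by
  have h1 := sum_hyperbolicEntropy_le_of_limit hα h hlim hw hv
  simp_rw [hyperbolicEntropy_eq hα] at h1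
  rw [Finset.sum_add_distrib, Finset.sum_add_distrib, ← Finset.mul_sum, ← Finset.mul_sum] at h1
  have h2 : ∑ i, (|w i| * Real.log |w i| - |w i| - 2 * α) ≤ ∑ i, entropyRemainder α (w i) :=
    Finset.sum_le_sum fun i _ => abs_mul_log_sub_abs_le_entropyRemainder hα.le _
  rw [Finset.sum_sub_distrib] at h2
  simp only [Finset.sum_const, Finset.card_univ, Fintype.card_fin, nsmul_eq_mul] at h2
  linarith

/-! ### Minimal `L_1` norm with an entropy tie-break -/

theorem vecLpNorm_one_le_iff {d : ℕ} (v w : EuclideanSpace ℝ (Fin d)) :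
    vecLpNorm 1 v ≤ vecLpNorm 1 w ↔ ∑ i, |v i| ≤ ∑ i, |w i| := by
  simpa using vecLpNorm_le_iff one_pos v w

theorem half_add_mul_log_lt {a b : ℝ} (ha : 0 ≤ a) (hb : 0 ≤ b) (hab : a ≠ b) :
    (a + b) / 2 * Real.log ((a + b) / 2) < (a * Real.log a + b * Real.log b) / 2 := by
  have h := Real.strictConvexOn_mul_log.2 ha hb hab
    (by norm_num : (0 : ℝ) < 1 / 2) (by norm_num : (0 : ℝ) < 1 / 2) (by norm_num)
  simp only [smul_eq_mul] at h
  rw [show 1 / 2 * a + 1 / 2 * b = (a + b) / 2 by ring] at h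
  linarith

/-- Among the elements of minimum `L_1` norm there is at most one of maximum entropy. -/
theorem eq_of_isMinLpNorm_one_of_entropy_le {N d : ℕ} {X : Matrix (Fin N) (Fin d) ℝ}
    {y : Fin N → ℝ} {v w : EuclideanSpace ℝ (Fin d)}
    (hv : IsMinLpNorm 1 (zeroErrorSet X y) v) (hw : IsMinLpNorm 1 (zeroErrorSet X y) w)
    (hve : ∀ u, IsMinLpNorm 1 (zeroErrorSet X y) u →
      ∑ i, (|v i| * Real.log |v i| - |v i|) ≤ ∑ i, (|u i| * Real.log |u i| - |u i|))
    (hwe : ∀ u, IsMinLpNorm 1 (zeroErrorSet X y) u →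
      ∑ i, (|w i| * Real.log |w i| - |w i|) ≤ ∑ i, (|u i| * Real.log |u i| - |u i|)) :
    v = w := by
  set m : EuclideanSpace ℝ (Fin d) := (1 / 2 : ℝ) • (v + w) with hm
  have hmE : m ∈ zeroErrorSet X y := midpoint_mem_zeroErrorSet hv.1 hw.1
  have hmi : ∀ i, |m i| = |v i + w i| / 2 := fun i => by
    simp only [hm, PiLp.smul_apply, PiLp.add_apply, smul_eq_mul, abs_mul]
    norm_num
    ring
  have hle : ∀ i ∈ Finset.univ, |m i| ≤ (|v i| + |w i|) / 2 := fun i _ => by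
    rw [hmi]
    linarith [abs_add_le (v i) (w i)]
  have hvw : ∑ i, |v i| = ∑ i, |w i| :=
    le_antisymm ((vecLpNorm_one_le_iff _ _).1 (hv.2 w hw.1))
      ((vecLpNorm_one_le_iff _ _).1 (hw.2 v hv.1))
  have hsum : ∑ i, (|v i| + |w i|) / 2 = ∑ i, |v i| := by
    rw [← Finset.sum_div, Finset.sum_add_distrib, ← hvw]
    ring
  -- Minimality of `v` forces equality in the summed triangle inequality, hence in every coordinate.
  have hms : ∑ i, |m i| = ∑ i, (|v i| + |w i|) / 2 :=
    le_antisymm (Finset.sum_le_sum hle)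
      (hsum.trans_le ((vecLpNorm_one_le_iff _ _).1 (hv.2 m hmE)))
  have heq := (Finset.sum_eq_sum_iff_of_le hle).1 hms
  have hmmin : IsMinLpNorm 1 (zeroErrorSet X y) m := by
    refine ⟨hmE, fun u hu => le_trans ?_ (hv.2 u hu)⟩
    rw [vecLpNorm_one_le_iff, hms, hsum]
  have h1 := hve m hmmin
  have h2 := hwe m hmmin
  -- Otherwise strict convexity of `x log x` makes the midpoint beat the average of `v` and `w`; the
  -- linear terms cancel because `m`, `v`, `w` have equal `L_1` norm.
  have habs : ∀ i, |v i| = |w i| := by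
    by_contra! hne
    obtain ⟨i, hi⟩ := hne
    have hlt : ∑ i, |m i| * Real.log |m i|
        < ∑ i, (|v i| * Real.log |v i| + |w i| * Real.log |w i|) / 2 := by
      refine Finset.sum_lt_sum (fun j hj => ?_) ⟨i, Finset.mem_univ i, ?_⟩
      · rw [heq j hj]
        by_cases h : |v j| = |w j|
        · rw [h, add_self_div_two, add_self_div_two]
        · exact (half_add_mul_log_lt (abs_nonneg _) (abs_nonneg _) h).le
      · rw [heq i (Finset.mem_univ i)]
        exact half_add_mul_log_lt (abs_nonneg _) (abs_nonneg _) hi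
    rw [← Finset.sum_div, Finset.sum_add_distrib] at hlt
    rw [Finset.sum_sub_distrib, Finset.sum_sub_distrib] at h1 h2
    linarith
  refine PiLp.ext fun i => ?_
  have h3 := heq i (Finset.mem_univ i)
  rw [hmi] at h3
  rcases abs_eq_abs.1 (habs i) with h | h
  · exact h
  -- Opposite signs with equality in the triangle inequality leave only zero.
  · have h4 : |v i| + |w i| = 0 := by
      rw [h] at h3 ⊢
      simp only [neg_add_cancel, abs_zero] at h3
      linarith
    have h5 : |v i| = 0 := by linarith [abs_nonneg (v i), abs_nonneg (w i)]
    have h6 : |w i| = 0 := by linarith [abs_nonneg (v i), abs_nonneg (w i)]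
    rw [abs_eq_zero.1 h5, abs_eq_zero.1 h6]

theorem exists_tendsto_isMinLpNorm_one {N d : ℕ} {X : Matrix (Fin N) (Fin d) ℝ}
    {y : Fin N → ℝ} {η : ℝ}
    {wp wm : ℝ → ℝ → EuclideanSpace ℝ (Fin d)} {winf : ℝ → EuclideanSpace ℝ (Fin d)}
    (hflow : ∀ᶠ α in 𝓝[>] (0 : ℝ),
      IsTemperedEGUPM 1 η (regressionLoss X y) (WithLp.toLp 2 fun _ => α) (wp α) (wm α))
    (hlim : ∀ᶠ α in 𝓝[>] (0 : ℝ),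
      Tendsto (fun t => wp α t - wm α t) atTop (𝓝 (winf α)))
    (hmem : ∀ᶠ α in 𝓝[>] (0 : ℝ), winf α ∈ zeroErrorSet X y) :
    ∃ w, IsMinLpNorm 1 (zeroErrorSet X y) w ∧ Tendsto winf (𝓝[>] (0 : ℝ)) (𝓝 w) := by
  have hpos : ∀ᶠ α in 𝓝[>] (0 : ℝ), 0 < α := eventually_mem_nhdsWithin
  have hlog : Tendsto (fun α => -Real.log α) (𝓝[>] (0 : ℝ)) atTop :=
    tendsto_neg_atBot_atTop.comp Real.tendsto_log_nhdsGT_zero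
  have hkey : ∀ v ∈ zeroErrorSet X y, ∀ᶠ α in 𝓝[>] (0 : ℝ),
      -Real.log α * ∑ i, |winf α i| + ∑ i, (|winf α i| * Real.log |winf α i| - |winf α i|) ≤
      -Real.log α * ∑ i, |v i| + (∑ i, entropyRemainder α (v i) + d * (2 * α)) := by
    intro v hv
    filter_upwards [hflow, hlim, hmem, hpos] with α h1 h2 h3 h4
    exact log_mul_sum_abs_add_entropyRemainder_le h4 h1 h2 h3 hv
  have hrem : ∀ v : EuclideanSpace ℝ (Fin d),
      Tendsto (fun α => ∑ i, entropyRemainder α (v i) + d * (2 * α)) (𝓝[>] (0 : ℝ))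
        (𝓝 (∑ i, (|v i| * Real.log |v i| - |v i|))) := by
    intro v
    have h1 : Tendsto (fun α : ℝ => (d : ℝ) * (2 * α)) (𝓝 0) (𝓝 0) := by
      have : Continuous fun α : ℝ => (d : ℝ) * (2 * α) := by fun_prop
      simpa using this.tendsto 0
    simpa using ((tendsto_finsetSum _ fun i _ => tendsto_entropyRemainder (v i)).add h1).mono_left
      (nhdsWithin_le_nhds (s := Set.Ioi 0))
  -- Divide the key bound by `-log α`; the extra `d` pays for the lower bound `-1` on each `x log x
  -- - x`, so no prior boundedness is needed.
  have hl1 : ∀ v ∈ zeroErrorSet X y, ∀ᶠ α in 𝓝[>] (0 : ℝ), ∑ i, |winf α i| ≤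
      ∑ i, |v i| + ((∑ i, entropyRemainder α (v i) + d * (2 * α)) + d) / -Real.log α := by
    intro v hv
    filter_upwards [hkey v hv, hlog.eventually_gt_atTop 0] with α h1 h2
    have h3 : ∑ _i : Fin d, (-1 : ℝ) ≤ ∑ i, (|winf α i| * Real.log |winf α i| - |winf α i|) :=
      Finset.sum_le_sum fun i _ => neg_one_le_mul_log_sub (abs_nonneg _)
    simp only [Finset.sum_const, Finset.card_univ, Fintype.card_fin, nsmul_eq_mul] at h3
    rw [← sub_le_iff_le_add', le_div_iff₀ h2]
    linarith
  have hl1lim : ∀ v : EuclideanSpace ℝ (Fin d), Tendsto (fun α => ∑ i, |v i| +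
      ((∑ i, entropyRemainder α (v i) + d * (2 * α)) + d) / -Real.log α) (𝓝[>] (0 : ℝ))
      (𝓝 (∑ i, |v i|)) := by
    intro v
    simpa using tendsto_const_nhds.add (((hrem v).add_const (d : ℝ)).div_atTop hlog)
  obtain ⟨α₀, hv₀⟩ := hmem.exists
  have hbound : ∀ᶠ α in 𝓝[>] (0 : ℝ), winf α ∈
      {w : EuclideanSpace ℝ (Fin d) | ∀ i, |w i| ≤ ∑ i, |winf α₀ i| + 1} := by
    filter_upwards [hl1 _ hv₀, (hl1lim (winf α₀)).eventually (ge_mem_nhds (lt_add_one _))]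
      with α h1 h2 i
    exact (Finset.single_le_sum (f := fun i => |winf α i|) (fun i _ => abs_nonneg _)
      (Finset.mem_univ i)).trans (h1.trans h2)
  suffices hP : ∀ w, MapClusterPt w (𝓝[>] (0 : ℝ)) winf →
      IsMinLpNorm 1 (zeroErrorSet X y) w ∧
      ∀ u, IsMinLpNorm 1 (zeroErrorSet X y) u →
        ∑ i, (|w i| * Real.log |w i| - |w i|) ≤ ∑ i, (|u i| * Real.log |u i| - |u i|) by
    obtain ⟨w, hw, hwlim⟩ := exists_tendsto_of_mapClusterPt_unique
      (isCompact_coordinate_box d (∑ i, |winf α₀ i| + 1)) hbound hP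
      fun v w hv hw => eq_of_isMinLpNorm_one_of_entropy_le hv.1 hw.1 hv.2 hw.2
    exact ⟨w, hw.1, hwlim⟩
  intro w hw
  obtain ⟨U, hU, hUw⟩ := mapClusterPt_iff_ultrafilter.1 hw
  have hcont : Continuous fun u : EuclideanSpace ℝ (Fin d) => ∑ i, |u i| :=
    continuous_finsetSum _ fun i _ => (PiLp.continuous_apply 2 _ i).abs
  have hcont' : Continuous fun u : EuclideanSpace ℝ (Fin d) =>
      ∑ i, (|u i| * Real.log |u i| - |u i|) :=
    continuous_finsetSum _ fun i _ =>
      (Real.continuous_mul_log.comp (PiLp.continuous_apply 2 _ i).abs).sub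
        (PiLp.continuous_apply 2 _ i).abs
  refine ⟨⟨(isClosed_zeroErrorSet X y).mem_of_tendsto hUw (hU hmem), fun v hv => ?_⟩,
    fun v hv => ?_⟩
  · rw [vecLpNorm_one_le_iff]
    exact le_of_tendsto_of_tendsto ((hcont.tendsto w).comp hUw) ((hl1lim v).mono_left hU)
      (hU (hl1 v hv))
  · refine le_of_tendsto_of_tendsto ((hcont'.tendsto w).comp hUw) ((hrem v).mono_left hU)
      (hU ?_)
    filter_upwards [hkey v hv.1, hmem, hlog.eventually_ge_atTop 0] with α h1 h2 h3
    -- As `v` has minimal `L_1` norm, the diverging terms of the key bound can be discarded, leaving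
    -- the entropy comparison.
    have h4 := mul_le_mul_of_nonneg_left ((vecLpNorm_one_le_iff _ _).1 (hv.2 _ h2)) h3
    simp only [Function.comp_apply]
    linarith

theorem theorem4 {N d : ℕ} (hNd : N < d) (X : Matrix (Fin N) (Fin d) ℝ) (y : Fin N → ℝ)
    (τ η : ℝ) (hτ0 : 0 ≤ τ) (hτ1 : τ ≤ 1) (hη : 0 < η)
    (wp wm : ℝ → ℝ → EuclideanSpace ℝ (Fin d)) (winf : ℝ → EuclideanSpace ℝ (Fin d))
    (hflow : ∀ᶠ α in 𝓝[>] (0 : ℝ),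
      IsTemperedEGUPM τ η (regressionLoss X y) (WithLp.toLp 2 fun _ => α) (wp α) (wm α))
    (hlim : ∀ᶠ α in 𝓝[>] (0 : ℝ),
      Tendsto (fun t => wp α t - wm α t) atTop (𝓝 (winf α)))
    (hmem : ∀ᶠ α in 𝓝[>] (0 : ℝ), winf α ∈ zeroErrorSet X y) :
    ∃ w : EuclideanSpace ℝ (Fin d),
      IsMinLpNorm (2 - τ) (zeroErrorSet X y) w ∧
      (τ < 1 → ∀ v, IsMinLpNorm (2 - τ) (zeroErrorSet X y) v → v = w) ∧
      Tendsto winf (𝓝[>] (0 : ℝ)) (𝓝 w) := by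
  rcases hτ1.lt_or_eq with hτ | rfl
  · obtain ⟨w, hw, hlimw⟩ := exists_tendsto_isMinLpNorm_of_lt_one hτ hflow hlim hmem
    exact ⟨w, hw, fun _ v hv => hv.unique (by linarith) hw, hlimw⟩
  · obtain ⟨w, hw, hlimw⟩ := exists_tendsto_isMinLpNorm_one hflow hlim hmem
    refine ⟨w, ?_, fun h => absurd h (lt_irrefl 1), hlimw⟩
    convert hw using 1
    norm_num
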